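/- Let $V$ be a finite-dimensional Euclidean vector space and let $\mathfrak h\subseteq\mathfrak{so}(V)$ be a Lie subalgebra acting irreducibly on $V$ (the action is automatically faithful). Let $\operatorname{Sym}^2\Lambda^2V$ be the space of 4-tensors on $V$ that are skew-symmetric in the first two arguments, skew-symmetric in the last two arguments and symmetric under exchange of these two pairs, and let $\mathcal K\subseteq\operatorname{Sym}^2\Lambda^2V$ be the space of algebraic curvature tensors, i.e. those $R$ with $$R(X,Y,Z,W)+R(Y,Z,X,W)+R(Z,X,Y,W)=0\qquad\text{for all }X,Y,Z,W\in V.$$ Let $\operatorname{Sym}\mathfrak h\subseteq\operatorname{Sym}^2\Lambda^2V$ be the subspace of symmetric endomorphisms of $\mathfrak h\subseteq\mathfrak{so}(V)\cong\Lambda^2V$, i.e. of those $R$ such that for all $X,Y\in V$ the endomorphism $R(X,Y)$ of $V$ defined by $\langle R(X,Y)Z,W\rangle=R(X,Y,Z,W)$ lies in $\mathfrak h$, and let $\mathcal K(\mathfrak h)=\mathcal K\cap\operatorname{Sym}\mathfrak h$, the representation of $\mathfrak h$ on algebraic curvature tensors with values in $\mathfrak h$. Suppose that $(V\otimes\mathfrak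 h)^{\mathfrak h}\neq0$. Then: 1. $\mathfrak h$ is simple, and $V\cong\mathfrak h$ as representations of $\mathfrak h$, where $\mathfrak h$ carries the adjoint representation. 2. If $\mathfrak h$ has rank at least $2$, then $\mathcal K(\mathfrak h)\cong\mathbb R$, the one-dimensional trivial representation. 3. If $\mathfrak h\cong\mathfrak{so}(3)$, then $\mathcal K(\mathfrak h)=\mathcal K$, and $\mathcal K(\mathfrak h)\cong\operatorname{Sym}^2\mathbb R^3$ as representations of $\mathfrak h\cong\mathfrak{so}(3)$. 4. Let $\varphi:V\to\mathfrak h$ be any isomorphism of representations of $\mathfrak h$, and let $\tau\in(V\otimes\mathfrak h)^{\mathfrak h}\subseteq(V\otimes\mathfrak{so}(V))^{\mathfrak h}$, regarded as the 3-tensor $\tau(X,Y,Z)=\langle\tau_XY,Z\rangle$, where $(v\otimes A)_X=\langle v,X\rangle A$. Then $\tau$ is a real multiple of the canonical 3-form $(X,Y,Z)\mapsto\langle\varphi^{-1}[\varphi X,\varphi Y],Z\rangle$ given by the Lie bracket of $\mathfrak h$; in particular $\tau$ is totally skew-symmetric. -/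

import Mathlib

open scoped TensorProduct RealInnerProductSpace

attribute [local instance 100] LieRing.ofAssociativeRing

namespace SkewCurv

section Orthogonal

variable (V : Type*) [NormedAddCommGroup V] [InnerProductSpace ℝ V]

/-- The Lie algebra `so(V)` of skew-symmetric endomorphisms of a Euclidean vector space `V`. -/
noncomputable abbrev so : LieSubalgebra ℝ (Module.End ℝ V) :=
  skewAdjointLieSubalgebra (innerₗ V)

variable {V}

theorem inner_so (x : so V) (Y Z : V) : ⟪⁅x, Y⁆, Z⟫ = -⟪Y, ⁅x, Z⁆⟫ := by
  have h := (LinearMap.mem_skewAdjointSubmodule (B := innerₗ V) (f := (x : Module.End ℝ V))).1 x.2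
  have h2 : ⟪(x : Module.End ℝ V) Y, Z⟫ = ⟪Y, -((x : Module.End ℝ V) Z)⟫ := h Y Z
  rw [inner_neg_right] at h2
  exact h2

end Orthogonal

section SymmetricSquare

variable (L M : Type*) [LieRing L] [LieAlgebra ℝ L] [AddCommGroup M] [Module ℝ M]
  [LieRingModule L M] [LieModule ℝ L M]

/-- The symmetric square `Sym² M` of a real representation `M` of `L`, realized as the
subrepresentation of symmetric tensors in `M ⊗ M`. -/
def symSq : LieSubmodule ℝ L (M ⊗[ℝ] M) where
  toSubmodule := LinearMap.eqLocus (TensorProduct.comm ℝ M M).toLinearMap LinearMap.id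
  lie_mem := by
    intro x t ht
    have key : ∀ s : M ⊗[ℝ] M,
        TensorProduct.comm ℝ M M ⁅x, s⁆ = ⁅x, TensorProduct.comm ℝ M M s⁆ := by
      intro s
      induction s using TensorProduct.induction_on with
      | zero => simp
      | tmul a b => simp [TensorProduct.LieModule.lie_tmul_right, add_comm]
      | add a b ha hb => simp [lie_add, ha, hb]
    have ht' : TensorProduct.comm ℝ M M t = t := ht
    show TensorProduct.comm ℝ M M ⁅x, t⁆ = ⁅x, t⁆
    rw [key, ht']

end SymmetricSquare

section Curvature

variable (V : Type*) [NormedAddCommGroup V] [InnerProductSpace ℝ V]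

/-- Covariant `4`-tensors on `V`. Using the metric to raise the last index, such a tensor is
written as a trilinear map `(X, Y, Z) ↦ R X Y Z ∈ V`, and the value of the tensor on
`(X, Y, Z, W)` is `⟪R X Y Z, W⟫`. The algebra `so(V)` acts by
`(x • R) X Y Z = x (R X Y Z) - R (x X) Y Z - R X (x Y) Z - R X Y (x Z)`. -/
abbrev Tensor4 : Type _ := V →ₗ[ℝ] V →ₗ[ℝ] V →ₗ[ℝ] V

variable {V}

theorem lie_tensor4_apply (x : so V) (R : Tensor4 V) (X Y Z : V) :
    ⁅x, R⁆ X Y Z = ⁅x, R X Y Z⁆ - R ⁅x, X⁆ Y Z - R X ⁅x, Y⁆ Z - R X Y ⁅x, Z⁆ := by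
  simp only [LieHom.lie_apply, LinearMap.sub_apply]
  abel

/-- The Bianchi map: the cyclic sum in the first three arguments. -/
def bianchi (R : Tensor4 V) (X Y Z : V) : V := R X Y Z + R Y Z X + R Z X Y

variable (V)

/-- The space `Sym² Λ² V`: the `4`-tensors which are skew-symmetric in the first pair of
arguments, skew-symmetric in the second pair, and symmetric under exchange of the two pairs. -/
def symSqLambda : LieSubmodule ℝ (so V) (Tensor4 V) where
  carrier := {R | (∀ X Y Z W, ⟪R X Y Z, W⟫ = -⟪R Y X Z, W⟫) ∧
    (∀ X Y Z W, ⟪R X Y Z, W⟫ = -⟪R X Y W, Z⟫) ∧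
    (∀ X Y Z W, ⟪R X Y Z, W⟫ = ⟪R Z W X, Y⟫)}
  zero_mem' := by simp
  add_mem' := by
    rintro R S ⟨a, b, c⟩ ⟨a', b', c'⟩
    refine ⟨fun X Y Z W => ?_, fun X Y Z W => ?_, fun X Y Z W => ?_⟩ <;>
      simp only [LinearMap.add_apply, inner_add_left]
    · rw [a, a']; ring
    · rw [b, b']; ring
    · rw [c, c']
  smul_mem' := by
    rintro t R ⟨a, b, c⟩
    refine ⟨fun X Y Z W => ?_, fun X Y Z W => ?_, fun X Y Z W => ?_⟩ <;>
      simp only [LinearMap.smul_apply, inner_smul_left]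
    · rw [a]; ring
    · rw [b]; ring
    · rw [c]
  lie_mem := by
    rintro x R ⟨a, b, c⟩
    refine ⟨fun X Y Z W => ?_, fun X Y Z W => ?_, fun X Y Z W => ?_⟩ <;>
      simp only [lie_tensor4_apply, inner_sub_left, inner_so]
    · linarith [a X Y Z ⁅x, W⁆, a ⁅x, X⁆ Y Z W, a X ⁅x, Y⁆ Z W, a X Y ⁅x, Z⁆ W]
    · linarith [b X Y Z ⁅x, W⁆, b ⁅x, X⁆ Y Z W, b X ⁅x, Y⁆ Z W, b X Y ⁅x, Z⁆ W]
    · linarith [c X Y Z ⁅x, W⁆, c ⁅x, X⁆ Y Z W, c X ⁅x, Y⁆ Z W, c X Y ⁅x, Z⁆ W]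

/-- The space `𝒦` of algebraic curvature tensors on `V`: the kernel of the Bianchi map on
`Sym² Λ² V`. -/
def curv : LieSubmodule ℝ (so V) (Tensor4 V) where
  carrier := {R | R ∈ symSqLambda V ∧ ∀ X Y Z, bianchi R X Y Z = 0}
  zero_mem' := ⟨zero_mem _, by simp [bianchi]⟩
  add_mem' := by
    rintro R S ⟨a, b⟩ ⟨a', b'⟩
    refine ⟨add_mem a a', fun X Y Z => ?_⟩
    have : bianchi (R + S) X Y Z = bianchi R X Y Z + bianchi S X Y Z := by
      simp only [bianchi, LinearMap.add_apply]; abel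
    rw [this, b, b', add_zero]
  smul_mem' := by
    rintro t R ⟨a, b⟩
    refine ⟨(symSqLambda V).smul_mem t a, fun X Y Z => ?_⟩
    have : bianchi (t • R) X Y Z = t • bianchi R X Y Z := by
      simp only [bianchi, LinearMap.smul_apply, smul_add]
    rw [this, b, smul_zero]
  lie_mem := by
    rintro x R ⟨a, b⟩
    refine ⟨(symSqLambda V).lie_mem a, fun X Y Z => ?_⟩
    have : bianchi ⁅x, R⁆ X Y Z = ⁅x, bianchi R X Y Z⁆ - bianchi R ⁅x, X⁆ Y Z
        - bianchi R X ⁅x, Y⁆ Z - bianchi R X Y ⁅x, Z⁆ := by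
      simp only [bianchi, lie_tensor4_apply, lie_add]; abel
    rw [this, b, b, b, b]; simp

variable {V}

/-- The space `Sym 𝔥` of symmetric endomorphisms of a subalgebra `𝔥 ⊆ so(V)`, viewed inside
`Sym² Λ² V`. An element of `Sym² Λ² V` is a symmetric endomorphism `X ∧ Y ↦ R X Y` of
`so(V) ≅ Λ² V`; the symmetric endomorphisms of `𝔥` (extended by zero to `𝔥^⊥`) are exactly those
with image in `𝔥`, i.e. with `R X Y ∈ 𝔥` for all `X, Y`. -/
def symOf (h : LieSubalgebra ℝ (so V)) : LieSubmodule ℝ h (Tensor4 V) where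
  carrier := {R | R ∈ symSqLambda V ∧
    ∀ X Y, ∃ A ∈ h, ∀ Z, R X Y Z = (A : Module.End ℝ V) Z}
  zero_mem' := ⟨zero_mem _, fun _ _ => ⟨0, zero_mem _, by simp⟩⟩
  add_mem' := by
    rintro R S ⟨a, b⟩ ⟨a', b'⟩
    refine ⟨add_mem a a', fun X Y => ?_⟩
    obtain ⟨A, hA, hR⟩ := b X Y
    obtain ⟨B, hB, hS⟩ := b' X Y
    exact ⟨A + B, add_mem hA hB, fun Z => by simp [hR, hS]⟩
  smul_mem' := by
    rintro t R ⟨a, b⟩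
    refine ⟨(symSqLambda V).smul_mem t a, fun X Y => ?_⟩
    obtain ⟨A, hA, hR⟩ := b X Y
    exact ⟨t • A, h.smul_mem t hA, fun Z => by simp [hR]⟩
  lie_mem := by
    rintro x R ⟨a, b⟩
    refine ⟨(symSqLambda V).lie_mem (x := (x : so V)) a, fun X Y => ?_⟩
    obtain ⟨A, hA, hR⟩ := b X Y
    obtain ⟨B, hB, hS⟩ := b ⁅(x : so V), X⁆ Y
    obtain ⟨C, hC, hT⟩ := b X ⁅(x : so V), Y⁆
    refine ⟨⁅(x : so V), A⁆ - B - C, sub_mem (sub_mem (h.lie_mem x.2 hA) hB) hC, fun Z => ?_⟩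
    have e : ⁅x, R⁆ X Y Z = ⁅(x : so V), R⁆ X Y Z := rfl
    rw [e, lie_tensor4_apply, hR, hR, hS, hT]
    have e2 : ((⁅(x : so V), A⁆ - B - C : so V) : Module.End ℝ V) Z
        = ⁅(x : so V), (A : Module.End ℝ V) Z⁆ - (A : Module.End ℝ V) ⁅(x : so V), Z⁆
          - (B : Module.End ℝ V) Z - (C : Module.End ℝ V) Z := rfl
    rw [e2]; abel

/-- The space `𝒦(𝔥) = 𝒦 ∩ Sym 𝔥` of algebraic curvature tensors with values in `𝔥`, as a
representation of `𝔥`. -/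
def curvOf (h : LieSubalgebra ℝ (so V)) : LieSubmodule ℝ h (Tensor4 V) where
  toSubmodule := (curv V).toSubmodule ⊓ (symOf h).toSubmodule
  lie_mem := by
    rintro x R ⟨a, b⟩
    exact ⟨(curv V).lie_mem (x := (x : so V)) a, (symOf h).lie_mem b⟩

end Curvature

section ThreeForm

variable {V : Type*} [NormedAddCommGroup V] [InnerProductSpace ℝ V]

/-- The contraction `V ⊗ 𝔥 → Hom(V, 𝔥)`, `τ ↦ (X ↦ τ_X)`, with `(v ⊗ A)_X = ⟪v, X⟫ A`, given by the
identification of `V` with its dual. -/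
noncomputable def contract (h : LieSubalgebra ℝ (so V)) : V ⊗[ℝ] h →ₗ[ℝ] V →ₗ[ℝ] h :=
  TensorProduct.lift ((LinearMap.smulRightₗ : (V →ₗ[ℝ] ℝ) →ₗ[ℝ] h →ₗ[ℝ] V →ₗ[ℝ] h) ∘ₗ innerₗ V)

theorem contract_tmul (h : LieSubalgebra ℝ (so V)) (v X : V) (A : h) :
    contract h (v ⊗ₜ A) X = ⟪v, X⟫ • A := by
  simp [contract]

/-- The covariant `3`-tensor `τ(X, Y, Z) = ⟪τ_X Y, Z⟫` corresponding to
`τ ∈ V ⊗ 𝔥 ⊆ V ⊗ so(V)`. -/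
noncomputable def tensor3 (h : LieSubalgebra ℝ (so V)) (τ : V ⊗[ℝ] h) (X Y Z : V) : ℝ :=
  ⟪⁅contract h τ X, Y⁆, Z⟫

/-- The bracket of `𝔥` transported to `V` along an isomorphism `φ : V ≅ 𝔥` of representations. -/
theorem symm_lie (h : LieSubalgebra ℝ (so V)) (φ : V ≃ₗ⁅ℝ, h⁆ h) (X Y : V) :
    φ.symm ⁅φ X, φ Y⁆ = ⁅φ X, Y⁆ := by
  have : ⁅φ X, φ Y⁆ = φ ⁅φ X, Y⁆ := (LieModuleHom.map_lie φ.toLieModuleHom (φ X) Y).symm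
  rw [this]
  exact φ.symm_apply_apply _

/-- The canonical `3`-form `⟨[·,·],·⟩` given by the Lie bracket of `𝔥`, on the vector space `V`
identified with `𝔥` by an isomorphism `φ : V ≅ 𝔥` of representations of `𝔥`. -/
noncomputable def canonicalForm (h : LieSubalgebra ℝ (so V)) (φ : V ≃ₗ⁅ℝ, h⁆ h) :
    V [⋀^Fin 3]→ₗ[ℝ] ℝ where
  toFun v := ⟪φ.symm ⁅φ (v 0), φ (v 1)⁆, v 2⟫
  map_update_add' := by
    intro inst m i x y
    cases Subsingleton.elim inst (instDecidableEqFin 3)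
    fin_cases i <;> simp [Function.update, inner_add_left, inner_add_right]
  map_update_smul' := by
    intro inst m i c x
    cases Subsingleton.elim inst (instDecidableEqFin 3)
    fin_cases i <;> simp [Function.update, inner_smul_left, inner_smul_right]
  map_eq_zero_of_eq' := by
    intro v i j hij hne
    have h01 : ∀ X Z : V, ⟪φ.symm ⁅φ X, φ X⁆, Z⟫ = 0 := by intro X Z; simp
    have h12 : ∀ X Y : V, ⟪φ.symm ⁅φ X, φ Y⁆, Y⟫ = 0 := by
      intro X Y
      have := inner_so (φ X : so V) Y Y
      rw [symm_lie]
      have e : ⁅φ X, Y⁆ = ⁅(φ X : so V), Y⁆ := rfl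
      rw [e]
      rw [real_inner_comm Y] at this
      rw [real_inner_comm]
      linarith
    have h02 : ∀ X Y : V, ⟪φ.symm ⁅φ X, φ Y⁆, X⟫ = 0 := by
      intro X Y
      have e : φ.symm ⁅φ X, φ Y⁆ = -φ.symm ⁅φ Y, φ X⁆ := by
        rw [← lie_skew (φ X) (φ Y)]
        exact map_neg φ.symm _
      rw [e, inner_neg_left, h12, neg_zero]
    fin_cases i <;> fin_cases j <;> simp at hij hne ⊢ <;> simp [hij, h12, h02]

theorem canonicalForm_apply (h : LieSubalgebra ℝ (so V)) (φ : V ≃ₗ⁅ℝ, h⁆ h) (X Y Z : V) :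
    canonicalForm h φ ![X, Y, Z] = ⟪φ.symm ⁅φ X, φ Y⁆, Z⟫ := rfl

end ThreeForm

end SkewCurv

/-! An invariant of `V ⊗ 𝔥` is an equivariant map `V → 𝔥`. A nonzero one is injective by
irreducibility and its image is an ideal. The complement of that ideal for the negative definite
trace form commutes with it, hence kills `V`, hence vanishes. So `V ≅ 𝔥` (`bijective_of_map_lie`),
and `V` becomes a simple Lie algebra with an invariant Euclidean product (`IsSimpleBracket`). The
operators commuting with `ad` are real scalars (`isScalar_of_comm`), which determines `τ` up to a
factor.

The elements of `Sym 𝔥` are the tensors `[S [X, Y], Z]` with `S` symmetric (`exists_endTensor_eq`),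
and for `S = id` the Bianchi identity is the Jacobi identity. In rank at least two nothing else
occurs (`isScalar_of_bianchi`). Let `t` be maximal abelian and `Z` a root vector for `α`. The
Bianchi identity on a root plane of `β` and an element of `ker β` shows that `S Z` is orthogonal to
the coroot of every `β` not proportional to `α`. So the `t`-component `u` of `S Z` is killed by all
these `β`, and `ad X ∘ ad u = 0` for `X` in `ker α`. As `ker α ≠ 0`, simplicity forces `u = 0`.
Since every `X` lies in some `t`, this gives `[S X, X] = 0`, so `S` commutes with `ad` and is
scalar.

For `so(3)`, `V` has dimension three, so `𝔥 = so(V)` and the Bianchi identity holds automatically;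
`𝒦(𝔥)` is then the space of all symmetric `S`, that is `Sym² V`. -/

namespace SkewCurv

/-! ### Simple Lie algebras with an invariant inner product, and their commutant -/

section SimpleBracket

variable {V : Type*} [NormedAddCommGroup V] [InnerProductSpace ℝ V]

/-- A simple Lie bracket on a Euclidean vector space for which all adjoint maps are
skew-symmetric. -/
structure IsSimpleBracket (B : V →ₗ[ℝ] V →ₗ[ℝ] V) : Prop where
  skew : ∀ X Y, B X Y = -B Y X
  inner_right : ∀ X Y Z, ⟪B X Y, Z⟫ = -⟪Y, B X Z⟫
  jacobi : ∀ X Y Z, B X (B Y Z) = B (B X Y) Z + B Y (B X Z)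
  faithful : ∀ X, (∀ Y, B X Y = 0) → X = 0
  simple : ∀ W : Submodule ℝ V, (∀ X, ∀ w ∈ W, B X w ∈ W) → W = ⊥ ∨ W = ⊤

namespace IsSimpleBracket

variable {B : V →ₗ[ℝ] V →ₗ[ℝ] V} (hB : IsSimpleBracket B)
include hB

theorem self (X : V) : B X X = 0 := by
  have h : (2 : ℝ) • B X X = 0 := by
    rw [two_smul]
    exact eq_neg_iff_add_eq_zero.1 (hB.skew X X)
  exact (smul_eq_zero.1 h).resolve_left two_ne_zero

theorem inner_assoc (X Y Z : V) : ⟪B X Y, Z⟫ = ⟪X, B Y Z⟫ := by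
  rw [hB.skew X Y, inner_neg_left, hB.inner_right, neg_neg]

theorem comm_of_eq_zero {X Y : V} (h : B X Y = 0) (Z : V) : B X (B Y Z) = B Y (B X Z) := by
  rw [hB.jacobi, h]; simp

theorem eq_zero_of_apply_apply {X Y : V} (h : B X (B X Y) = 0) : B X Y = 0 := by
  have : ⟪B X Y, B X Y⟫ = 0 := by rw [hB.inner_right, h]; simp
  exact inner_self_eq_zero.1 this

/-- The bracket is surjective, in the sense that nothing is orthogonal to all brackets. -/
theorem eq_zero_of_inner_lie {Q : V} (h : ∀ X Y, ⟪Q, B X Y⟫ = 0) : Q = 0 :=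
  hB.faithful Q fun Y => ext_inner_right ℝ fun Z => by rw [hB.inner_assoc, h, inner_zero_left]

variable [FiniteDimensional ℝ V]

theorem eq_top_of_lie_mem {W : Submodule ℝ V} (hW : ∀ X Y, B X Y ∈ W) : W = ⊤ := by
  rw [← Submodule.orthogonal_eq_bot_iff, Submodule.eq_bot_iff]
  exact fun Q hQ => hB.eq_zero_of_inner_lie fun X Y =>
    (Submodule.mem_orthogonal' _ _).1 hQ _ (hW X Y)

/-- Schur's lemma: a symmetric operator has a real eigenvalue, and the eigenspace is an ideal. -/
theorem isScalar_of_isSymmetric {f : V →ₗ[ℝ] V} (hs : f.IsSymmetric)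
    (hf : ∀ X Y, f (B X Y) = B X (f Y)) : ∃ c : ℝ, ∀ X, f X = c • X := by
  rcases subsingleton_or_nontrivial V with hV | hV
  · exact ⟨0, fun X => Subsingleton.elim _ _⟩
  have he := hs.hasEigenvalue_iSup_of_finiteDimensional
  set c : ℝ := _
  change Module.End.HasEigenvalue f c at he
  refine ⟨c, fun X => ?_⟩
  have := hB.simple (Module.End.eigenspace f c) (fun X w hw => by
    rw [Module.End.mem_eigenspace_iff] at hw ⊢
    rw [hf, hw, map_smul])
  rcases this with h | h
  · exact absurd h he
  · exact Module.End.mem_eigenspace_iff.1 (h ▸ Submodule.mem_top)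

/-- The definite invariant product excludes a complex structure: the skew part `d` of `f` also
commutes with `ad`, and is shown to vanish. -/
theorem isSymmetric_of_comm {f : V →ₗ[ℝ] V}
    (hf : ∀ X Y, f (B X Y) = B X (f Y)) : f.IsSymmetric := by
  set g := LinearMap.adjoint f
  have hg : ∀ X Y, g (B X Y) = B X (g Y) := fun X Y => ext_inner_right ℝ fun Z => by
    rw [LinearMap.adjoint_inner_left, hB.inner_right, hB.inner_right, ← hf,
      LinearMap.adjoint_inner_left]
  set d := f - g with hd
  have hdc : ∀ X Y, d (B X Y) = B X (d Y) := fun X Y => by simp [hd, hf, hg]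
  have hds : ∀ X Y, ⟪d X, Y⟫ = -⟪X, d Y⟫ := fun X Y => by
    simp only [hd, LinearMap.sub_apply, inner_sub_left, inner_sub_right]
    rw [LinearMap.adjoint_inner_left, LinearMap.adjoint_inner_right]; ring
  have hdl : ∀ X Y, B (d X) Y = d (B X Y) := fun X Y => by
    rw [hB.skew, ← hdc, hB.skew Y X, map_neg, neg_neg]
  have hd0 : ∀ X, d X = 0 := fun X => hB.faithful _ fun Y => ext_inner_right ℝ fun Z => by
    -- Moving `ad (d X) = d ∘ ad X` across the product as one skew operator, or as two commuting
    -- skew operators, gives opposite signs.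
    have h1 := hB.inner_right (d X) Y Z
    rw [hdl, hdl, hds, hdc, hB.inner_right] at h1
    rw [hdl, hds, hB.inner_right, inner_zero_left]
    linarith
  have : g = f := by
    ext X
    have := hd0 X
    rw [hd, LinearMap.sub_apply, sub_eq_zero] at this
    exact this.symm
  intro X Y
  conv_lhs => rw [← this]
  exact LinearMap.adjoint_inner_left _ _ _

theorem isScalar_of_comm {f : V →ₗ[ℝ] V}
    (hf : ∀ X Y, f (B X Y) = B X (f Y)) : ∃ c : ℝ, ∀ X, f X = c • X :=
  hB.isScalar_of_isSymmetric (hB.isSymmetric_of_comm hf) hf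

/-- Polarizing gives `[S X, Y] = [X, S Y]`; with the symmetry of `S` this makes `S` commute with
`ad`. -/
theorem isScalar_of_lie_self {S : V →ₗ[ℝ] V} (hs : S.IsSymmetric)
    (h : ∀ X, B (S X) X = 0) : ∃ c : ℝ, ∀ X, S X = c • X := by
  have h2 : ∀ X Y, B (S X) Y = B X (S Y) := fun X Y => by
    have := h (X + Y)
    simp only [map_add, LinearMap.add_apply, h, zero_add, add_zero] at this
    rw [hB.skew X (S Y)]
    exact eq_neg_of_add_eq_zero_left (by rw [add_comm] at this ⊢; simpa [add_comm] using this)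
  refine hB.isScalar_of_isSymmetric hs fun X Y => ext_inner_right ℝ fun Z => ?_
  rw [hs, hB.inner_right, ← h2, ← h2, hB.inner_right]

/-- If `X` commutes with the range of `ad u` and `u ≠ 0` then `X = 0`. -/
theorem eq_zero_of_lie_range {u X : V} (hu : u ≠ 0) (hX : ∀ Y, B X (B u Y) = 0) : X = 0 := by
  let W : Submodule ℝ V :=
    { carrier := {w | ∀ Y, B w (B u Y) = 0}
      add_mem' := fun {a b} ha hb Y => by simp [ha Y, hb Y]
      zero_mem' := fun Y => by simp
      smul_mem' := fun c a ha Y => by simp [ha Y] }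
  have hperp : ∀ v ∈ (LinearMap.range (B u))ᗮ, B u v = 0 := fun v hv => by
    have : ⟪B u v, B u v⟫ = 0 := by
      rw [hB.inner_right, real_inner_comm,
        (Submodule.mem_orthogonal _ _).1 hv _ (LinearMap.mem_range_self _ _), neg_zero]
    exact inner_self_eq_zero.1 this
  -- The centralizer `W` of the range of `ad u` is an ideal: `V` is the sum of that range, which
  -- kills `W`, and of `ker (ad u)`, which preserves the range and hence `W`.
  have hW : ∀ X, ∀ w ∈ W, B X w ∈ W := by
    intro v w hw
    have hv : v ∈ LinearMap.range (B u) ⊔ (LinearMap.range (B u))ᗮ := by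
      rw [Submodule.sup_orthogonal_of_hasOrthogonalProjection]; trivial
    obtain ⟨_, ⟨y, rfl⟩, z, hz, rfl⟩ := Submodule.mem_sup.1 hv
    intro Y
    have h1 : B (B u y) w = 0 := by rw [hB.skew, hw y, neg_zero]
    have h2 : B z (B u Y) = B u (B z Y) :=
      hB.comm_of_eq_zero (by rw [hB.skew, hperp z hz, neg_zero]) Y
    have h3 := hB.jacobi z w (B u Y)
    rw [hw Y, h2, hw, map_zero, add_zero] at h3
    rw [map_add, LinearMap.add_apply, h1, zero_add, ← h3]
  rcases hB.simple W hW with h | h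
  · have : X ∈ W := hX
    rw [h] at this
    exact (Submodule.mem_bot _).1 this
  · refine absurd (hB.faithful u fun Y => hB.faithful _ fun Z => ?_) hu
    have : Z ∈ W := h ▸ Submodule.mem_top
    rw [hB.skew, this Y, neg_zero]

/-! ### Real root vectors and the Bianchi identity in rank at least two -/

omit [FiniteDimensional ℝ V] hB in
/-- `Z` is a common eigenvector of all `ad H ∘ ad K` with `H, K ∈ t`. -/
def IsWeightVector (B : V →ₗ[ℝ] V →ₗ[ℝ] V) (t : Submodule ℝ V) (Z : V) : Prop :=
  ∀ H ∈ t, ∀ K ∈ t, ∃ q : ℝ, B H (B K Z) = q • Z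

/-- A skew `ad H` has no real eigenvectors for nonzero eigenvalues, but the products `ad H ∘ ad K`
are commuting symmetric operators, so they are simultaneously diagonalizable over `ℝ`. -/
theorem eq_top_of_isWeightVector {t : Submodule ℝ V} (ht : ∀ X ∈ t, ∀ Y ∈ t, B X Y = 0)
    {W : Submodule ℝ V} (hW : ∀ Z, IsWeightVector B t Z → Z ∈ W) : W = ⊤ := by
  let T : t × t → V →ₗ[ℝ] V := fun p => B p.1 ∘ₗ B p.2
  have hc : ∀ a b : t, ∀ Y, B (a : V) (B (b : V) Y) = B (b : V) (B (a : V) Y) := fun a b Y =>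
    hB.comm_of_eq_zero (ht a a.2 b b.2) Y
  have h := LinearMap.IsSymmetric.iSup_iInf_eq_top_of_commute (T := T)
    (fun p X Y => by
      simp only [T, LinearMap.comp_apply]
      rw [hB.inner_right, hB.inner_right, neg_neg, hc])
    (fun p q _ => by
      refine LinearMap.ext fun Y => ?_
      change B (p.1 : V) (B (p.2 : V) (B (q.1 : V) (B (q.2 : V) Y)))
        = B (q.1 : V) (B (q.2 : V) (B (p.1 : V) (B (p.2 : V) Y)))
      rw [hc p.2 q.1, hc p.1 q.1, hc p.2 q.2, hc p.1 q.2])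
  rw [eq_top_iff, ← h]
  refine iSup_le fun χ Z hZ => hW Z fun H hH K hK => ⟨χ (⟨H, hH⟩, ⟨K, hK⟩), ?_⟩
  have := (Submodule.mem_iInf _).1 hZ (⟨H, hH⟩, ⟨K, hK⟩)
  exact Module.End.mem_eigenspace_iff.1 this

omit [FiniteDimensional ℝ V] in
theorem IsWeightVector.lie {t : Submodule ℝ V} (ht : ∀ X ∈ t, ∀ Y ∈ t, B X Y = 0) {Z : V}
    (hZ : IsWeightVector B t Z) {X : V} (hX : X ∈ t) : IsWeightVector B t (B X Z) := by
  intro H hH K hK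
  obtain ⟨q, hq⟩ := hZ H hH K hK
  refine ⟨q, ?_⟩
  rw [hB.comm_of_eq_zero (ht K hK X hX), hB.comm_of_eq_zero (ht H hH X hX), hq, map_smul]

omit [FiniteDimensional ℝ V] in
-- The ratio `c` plays the role of `α(K) / α(H)` for the root `α` of `Z`.
theorem IsWeightVector.exists_smul {t : Submodule ℝ V} (ht : ∀ X ∈ t, ∀ Y ∈ t, B X Y = 0) {Z : V}
    (hZ : IsWeightVector B t Z) {H : V} (hH : H ∈ t) (h0 : B H Z ≠ 0) {K : V} (hK : K ∈ t) :
    ∃ c : ℝ, B K Z = c • B H Z := by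
  obtain ⟨q, hq⟩ := hZ H hH H hH
  obtain ⟨r, hr⟩ := hZ H hH K hK
  have hq0 : q ≠ 0 := by
    rintro rfl
    exact h0 (hB.eq_zero_of_apply_apply (by rw [hq, zero_smul]))
  refine ⟨r / q, ?_⟩
  have h1 : q • B K Z = r • B H Z := by
    rw [← map_smul, ← hq, ← hB.comm_of_eq_zero (ht H hH K hK), ← hB.comm_of_eq_zero (ht H hH K hK),
      hr, map_smul]
  rw [div_eq_inv_mul, mul_smul, ← h1, smul_smul, inv_mul_cancel₀ hq0, one_smul]

/-- A symmetric endomorphism satisfying the Bianchi identity maps weight spaces for nonzero weights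
of a maximal abelian subspace of dimension at least two to the orthogonal complement of that
subspace. -/
theorem inner_eq_zero_of_isWeightVector {S : V →ₗ[ℝ] V} (hs : S.IsSymmetric)
    (hb : ∀ X Y Z, B (S (B X Y)) Z + B (S (B Y Z)) X + B (S (B Z X)) Y = 0)
    {t : Submodule ℝ V} (ht : ∀ X ∈ t, ∀ Y ∈ t, B X Y = 0)
    (hmax : ∀ Y, (∀ X ∈ t, B X Y = 0) → Y ∈ t)
    (ht2 : ∀ H ∈ t, ∃ X ∈ t, X ∉ Submodule.span ℝ {H})
    {Z : V} (hZ : IsWeightVector B t Z) {H₀ : V} (hH₀ : H₀ ∈ t) (h0 : B H₀ Z ≠ 0)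
    {H : V} (hH : H ∈ t) : ⟪S Z, H⟫ = 0 := by
  -- `[Y, [K, Y]]` is a multiple of the coroot of `Y`. By Bianchi its image under `S` commutes with
  -- `X`, whereas `Z` is a multiple of `[X, [X, Z]]`.
  have key : ∀ Y, IsWeightVector B t Y → ∀ X ∈ t, B X Y = 0 → B X Z ≠ 0 → ∀ K ∈ t,
      ⟪S Z, B Y (B K Y)⟫ = 0 := by
    intro Y hY X hX hXY hXZ K hK
    obtain ⟨q, hq⟩ := hZ X hX X hX
    have hq0 : q ≠ 0 := by
      rintro rfl
      exact hXZ (hB.eq_zero_of_apply_apply (by rw [hq, zero_smul]))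
    have h1 := hb Y (B K Y) X
    have h2 : B X (B K Y) = 0 := by rw [hB.comm_of_eq_zero (ht X hX K hK), hXY, map_zero]
    rw [hB.skew (B K Y) X, h2, hXY] at h1
    simp only [neg_zero, map_zero, LinearMap.zero_apply, add_zero] at h1
    have h3 : ⟪S (q • Z), B Y (B K Y)⟫ = 0 := by
      rw [hs, ← hq, hB.inner_right, real_inner_comm, hB.skew X, h1]; simp
    rw [map_smul, inner_smul_left] at h3
    exact (mul_eq_zero.1 h3).resolve_left hq0
  set u : V := t.starProjection (S Z) with hu
  have hut : u ∈ t := Submodule.starProjection_apply_mem _ _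
  have hui : ∀ K ∈ t, ⟪u, K⟫ = ⟪S Z, K⟫ := fun K hK => by
    rw [hu, Submodule.inner_starProjection_left_eq_right,
      Submodule.starProjection_eq_self_iff.2 hK]
  rw [← hui H hH]
  by_cases hu0 : u = 0
  · rw [hu0, inner_zero_left]
  exfalso
  have huY : ∀ X ∈ t, B X Z = 0 → ∀ Y, B X (B u Y) = 0 := by
    intro X hX hXZ
    suffices hk : LinearMap.ker (B X ∘ₗ B u) = ⊤ from fun Y =>
      LinearMap.mem_ker.1 (hk ▸ Submodule.mem_top : Y ∈ LinearMap.ker (B X ∘ₗ B u))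
    refine hB.eq_top_of_isWeightVector ht fun Y hY => ?_
    rw [LinearMap.mem_ker, LinearMap.comp_apply]
    by_cases hXY : B X Y = 0
    · rw [hB.comm_of_eq_zero (ht X hX u hut), hXY, map_zero]
    obtain ⟨c, hc⟩ := IsWeightVector.exists_smul hB ht hY hX hXY hH₀
    obtain ⟨d, hd⟩ := IsWeightVector.exists_smul hB ht hY hX hXY hut
    -- The coroot commutes with `t`, so it lies in `t` by maximality.
    have hT : B Y (B X Y) ∈ t := hmax _ fun K hK => by
      obtain ⟨a, ha⟩ := IsWeightVector.exists_smul hB ht hY hX hXY hK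
      obtain ⟨q, hq⟩ := hY K hK X hX
      rw [hB.jacobi, ha, hq, map_smul, map_smul, LinearMap.smul_apply, hB.self, hB.self]
      simp
    -- `H₀ - c • X` kills `Y` but not `Z`, since `X` kills `Z` and `H₀` does not.
    have h1 := key Y hY (H₀ - c • X) (t.sub_mem hH₀ (t.smul_mem c hX)) (by simp [hc])
      (by simpa [hXZ] using h0) X hX
    rw [← hui _ hT, ← hB.inner_assoc, hd, inner_smul_left] at h1
    rcases mul_eq_zero.1 h1 with h2 | h2
    · have : d = 0 := h2
      rw [hd, this]; simp
    · exact absurd (inner_self_eq_zero.1 h2) hXY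
  obtain ⟨X, hX, hXs⟩ := ht2 H₀ hH₀
  obtain ⟨c, hc⟩ := IsWeightVector.exists_smul hB ht hZ hH₀ h0 hX
  have h1 : X - c • H₀ = 0 := hB.eq_zero_of_lie_range hu0
    (huY _ (t.sub_mem hX (t.smul_mem c hH₀)) (by simp [hc]))
  exact hXs (Submodule.mem_span_singleton.2 ⟨c, (sub_eq_zero.1 h1).symm⟩)

theorem exists_maximal_abelian (X : V) : ∃ t : Submodule ℝ V, X ∈ t ∧
    (∀ X ∈ t, ∀ Y ∈ t, B X Y = 0) ∧ ∀ Y, (∀ X ∈ t, B X Y = 0) → Y ∈ t := by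
  let s : Set (Submodule ℝ V) := {t | X ∈ t ∧ ∀ X ∈ t, ∀ Y ∈ t, B X Y = 0}
  have hs : s.Nonempty := by
    refine ⟨Submodule.span ℝ {X}, Submodule.mem_span_singleton_self X, ?_⟩
    intro Y hY Z hZ
    obtain ⟨a, rfl⟩ := Submodule.mem_span_singleton.1 hY
    obtain ⟨b, rfl⟩ := Submodule.mem_span_singleton.1 hZ
    simp [hB.self]
  -- A minimum for `>` is a maximal element.
  obtain ⟨t, ⟨hXt, ht⟩, hm⟩ := wellFounded_gt.has_min s hs
  refine ⟨t, hXt, ht, fun Y hY => ?_⟩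
  have h1 : t ⊔ Submodule.span ℝ {Y} ∈ s := by
    refine ⟨Submodule.mem_sup_left hXt, fun P hP Q hQ => ?_⟩
    obtain ⟨p, hp, _, ha, rfl⟩ := Submodule.mem_sup.1 hP
    obtain ⟨q, hq, _, hb, rfl⟩ := Submodule.mem_sup.1 hQ
    obtain ⟨a, rfl⟩ := Submodule.mem_span_singleton.1 ha
    obtain ⟨b, rfl⟩ := Submodule.mem_span_singleton.1 hb
    have h2 := hB.skew Y q
    rw [hY q hq] at h2
    simp [ht p hp q hq, hY p hp, h2, hB.self]
  have h2 := hm _ h1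
  have h3 : t = t ⊔ Submodule.span ℝ {Y} := eq_of_le_of_not_lt le_sup_left h2
  rw [h3]
  exact Submodule.mem_sup_right (Submodule.mem_span_singleton_self Y)

/-- If all centralizers have dimension at least two, then a symmetric endomorphism satisfying the
Bianchi identity is a multiple of the identity. -/
theorem isScalar_of_bianchi (hr : ∀ X, ∃ Y, B X Y = 0 ∧ Y ∉ Submodule.span ℝ {X})
    {S : V →ₗ[ℝ] V} (hs : S.IsSymmetric)
    (hb : ∀ X Y Z, B (S (B X Y)) Z + B (S (B Y Z)) X + B (S (B Z X)) Y = 0) :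
    ∃ c : ℝ, ∀ X, S X = c • X := by
  refine hB.isScalar_of_lie_self hs fun X => ?_
  obtain ⟨t, hXt, ht, hmax⟩ := hB.exists_maximal_abelian X
  have ht2 : ∀ H ∈ t, ∃ X ∈ t, X ∉ Submodule.span ℝ {H} := by
    intro H hH
    by_contra! hcon
    obtain ⟨Y, hY, hYH⟩ := hr H
    refine hYH (hcon Y (hmax Y fun K hK => ?_))
    obtain ⟨a, rfl⟩ := Submodule.mem_span_singleton.1 (hcon K hK)
    simp [hY]
  -- `⟪[S X, X], Y⟫ = ⟪S X, [X, Y]⟫`, which may be tested on weight vectors `Y`; then `[X, Y]` is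
  -- again one.
  have h1 : LinearMap.ker ((innerₗ V (S X)) ∘ₗ B X) = ⊤ := by
    refine hB.eq_top_of_isWeightVector ht fun Y hY => ?_
    rw [LinearMap.mem_ker, LinearMap.comp_apply, innerₗ_apply_apply]
    by_cases hXY : B X Y = 0
    · rw [hXY, inner_zero_right]
    rw [hs, real_inner_comm]
    exact hB.inner_eq_zero_of_isWeightVector hs hb ht hmax ht2
      (IsWeightVector.lie hB ht hY hXt) hXt
      (fun h => hXY (hB.eq_zero_of_apply_apply h)) hXt
  refine ext_inner_right ℝ fun Y => ?_
  rw [hB.inner_assoc, inner_zero_left]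
  exact LinearMap.mem_ker.1 (h1 ▸ Submodule.mem_top : Y ∈ LinearMap.ker ((innerₗ V (S X)) ∘ₗ B X))

end IsSimpleBracket

end SimpleBracket

/-! ### The isomorphism `V ≅ 𝔥`, simplicity, and the invariant 3-tensors -/

section Bracket

variable {V : Type*} [NormedAddCommGroup V] [InnerProductSpace ℝ V]
  {h : LieSubalgebra ℝ (so V)}

theorem inner_lie (x : h) (Y Z : V) : ⟪⁅x, Y⁆, Z⟫ = -⟪Y, ⁅x, Z⁆⟫ := inner_so (x : so V) Y Z

theorem eq_zero_of_lie_eq_zero {x : h} (hx : ∀ Y : V, ⁅x, Y⁆ = 0) : x = 0 :=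
  Subtype.ext (Subtype.ext (LinearMap.ext hx))

/-- The bracket of `𝔥` transported to `V` along an isomorphism `V ≅ 𝔥`. -/
noncomputable def bracket (φ : V ≃ₗ⁅ℝ, h⁆ h) : V →ₗ[ℝ] V →ₗ[ℝ] V :=
  LinearMap.mk₂ ℝ (fun X Y => ⁅φ X, Y⁆)
    (fun X X' Y => by rw [map_add, add_lie]) (fun c X Y => by rw [map_smul, smul_lie])
    (fun X Y Y' => lie_add _ _ _) (fun c X Y => lie_smul _ _ _)

@[simp]
theorem bracket_apply (φ : V ≃ₗ⁅ℝ, h⁆ h) (X Y : V) : bracket φ X Y = ⁅φ X, Y⁆ := rfl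

theorem map_lie_equiv (φ : V ≃ₗ⁅ℝ, h⁆ h) (x : h) (Y : V) : φ ⁅x, Y⁆ = ⁅x, φ Y⁆ :=
  LieModuleHom.map_lie φ.toLieModuleHom x Y

theorem lie_equiv_skew (φ : V ≃ₗ⁅ℝ, h⁆ h) (X Y : V) : ⁅φ X, Y⁆ = -⁅φ Y, X⁆ := by
  apply φ.injective
  rw [map_neg, map_lie_equiv, map_lie_equiv, lie_skew]

theorem isSimpleBracket_bracket (hirr : LieModule.IsIrreducible ℝ h V) (φ : V ≃ₗ⁅ℝ, h⁆ h) :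
    IsSimpleBracket (bracket φ) where
  skew X Y := lie_equiv_skew φ X Y
  inner_right X Y Z := inner_lie _ _ _
  jacobi X Y Z := by
    simp only [bracket_apply]
    rw [leibniz_lie, map_lie_equiv]
  faithful X hX := by
    have : φ X = 0 := eq_zero_of_lie_eq_zero hX
    exact (map_eq_zero_iff φ φ.injective).1 this
  simple W hW := by
    let N : LieSubmodule ℝ h V :=
      { W with
        lie_mem := fun {x m} hm => by
          have := hW (φ.symm x) m hm
          rwa [bracket_apply, φ.apply_symm_apply] at this }
    rcases eq_bot_or_eq_top N with hN | hN
    · left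
      exact (LieSubmodule.toSubmodule_eq_bot (N := N)).2 hN
    · right
      exact (LieSubmodule.toSubmodule_eq_top (N := N)).2 hN

variable [FiniteDimensional ℝ V]

section InnerTensorHom

variable (V) (N : Type*) [AddCommGroup N] [Module ℝ N]

/-- The isomorphism `V ⊗ N ≅ Hom(V, N)` given by the inner product of `V`. -/
noncomputable def innerTensorHom : V ⊗[ℝ] N ≃ₗ[ℝ] V →ₗ[ℝ] N :=
  (TensorProduct.congr
    ((innerₗ V).linearEquivOfInjective (fun _ _ hXY => ext_inner_right ℝ fun Z =>
      LinearMap.congr_fun hXY Z) Subspace.dual_finrank_eq.symm)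
    (LinearEquiv.refl ℝ N)).trans (dualTensorHomEquiv ℝ V N)

theorem innerTensorHom_tmul (v X : V) (n : N) : innerTensorHom V N (v ⊗ₜ n) X = ⟪v, X⟫ • n := rfl

end InnerTensorHom

theorem contract_injective (h : LieSubalgebra ℝ (so V)) : Function.Injective (contract h) := by
  have : contract h = (innerTensorHom V h).toLinearMap := by
    ext v A X
    simp [contract_tmul, innerTensorHom_tmul]
  rw [this]
  exact (innerTensorHom V h).injective

omit [FiniteDimensional ℝ V] in
theorem contract_lie (x : h) (τ : V ⊗[ℝ] h) (X : V) :
    contract h ⁅x, τ⁆ X = ⁅x, contract h τ X⁆ - contract h τ ⁅x, X⁆ := by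
  induction τ using TensorProduct.induction_on with
  | zero => simp
  | tmul v A =>
    rw [TensorProduct.LieModule.lie_tmul_right, map_add, LinearMap.add_apply, contract_tmul,
      contract_tmul, contract_tmul, contract_tmul, inner_lie, lie_smul, neg_smul]
    abel
  | add a b ha hb =>
    simp only [lie_add, map_add, LinearMap.add_apply, ha, hb]; abel

omit [FiniteDimensional ℝ V] in
theorem contract_map_lie {τ : V ⊗[ℝ] h} (hτ : τ ∈ LieModule.maxTrivSubmodule ℝ h (V ⊗[ℝ] h))
    (x : h) (X : V) : contract h τ ⁅x, X⁆ = ⁅x, contract h τ X⁆ := by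
  have := contract_lie x τ X
  rw [(LieModule.mem_maxTrivSubmodule _ _ _ τ).1 hτ x, map_zero, LinearMap.zero_apply] at this
  exact (sub_eq_zero.1 this.symm).symm

/-- A nonzero equivariant map from an irreducible `V` to `𝔥 ⊆ so(V)` is an isomorphism. -/
theorem bijective_of_map_lie (hirr : LieModule.IsIrreducible ℝ h V) {T : V →ₗ[ℝ] h}
    (hT0 : T ≠ 0) (hT : ∀ (x : h) (X : V), T ⁅x, X⁆ = ⁅x, T X⁆) : Function.Bijective T := by
  have hinj : Function.Injective T := by
    let N : LieSubmodule ℝ h V :=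
      { LinearMap.ker T with
        lie_mem := fun {x m} hm => by
          have hm : T m = 0 := hm
          change T ⁅x, m⁆ = 0
          rw [hT, hm, lie_zero] }
    rcases eq_bot_or_eq_top N with hN | hN
    · exact LinearMap.ker_eq_bot.1 ((LieSubmodule.toSubmodule_eq_bot (N := N)).2 hN)
    · exact absurd (LinearMap.ker_eq_top.1 ((LieSubmodule.toSubmodule_eq_top (N := N)).2 hN)) hT0
  refine ⟨hinj, fun A => ?_⟩
  let β : h →ₗ[ℝ] h →ₗ[ℝ] ℝ := LieModule.traceForm ℝ h V
  have hdef : ∀ x : h, β x x = 0 → x = 0 := by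
    intro x hx
    rw [LieModule.traceForm_apply_apply,
      LinearMap.trace_eq_sum_inner _ (stdOrthonormalBasis ℝ V)] at hx
    have h1 : ∀ i, ⁅x, stdOrthonormalBasis ℝ V i⁆ = 0 := by
      have h2 : ∑ i, ⟪⁅x, stdOrthonormalBasis ℝ V i⁆, ⁅x, stdOrthonormalBasis ℝ V i⁆⟫ = 0 := by
        rw [← neg_eq_zero, ← Finset.sum_neg_distrib, ← hx]
        refine Finset.sum_congr rfl fun i _ => ?_
        rw [inner_lie, neg_neg]; rfl
      intro i
      exact inner_self_eq_zero.1 ((Finset.sum_eq_zero_iff_of_nonneg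
        fun i _ => real_inner_self_nonneg).1 h2 i (Finset.mem_univ i))
    have h3 : LieModule.toEnd ℝ h V x = 0 :=
      (stdOrthonormalBasis ℝ V).toBasis.ext fun i => by
        rw [OrthonormalBasis.coe_toBasis]; exact h1 i
    exact eq_zero_of_lie_eq_zero fun Y => LinearMap.congr_fun h3 Y
  let γ : V →ₗ[ℝ] Module.Dual ℝ V := (β ∘ₗ T).compl₂ T
  have hγ : Function.Injective γ := by
    refine (injective_iff_map_eq_zero γ).2 fun X hX => ?_
    have : γ X X = 0 := by rw [hX]; rfl
    exact (map_eq_zero_iff T hinj).1 (hdef _ this)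
  have hγs : Function.Surjective γ :=
    (LinearMap.injective_iff_surjective_of_finrank_eq_finrank Subspace.dual_finrank_eq.symm).1 hγ
  -- `T X` is the trace-form projection of `A` to the image of `T`; the remainder `A - T X` is shown
  -- to act by zero on `V`.
  obtain ⟨X, hX⟩ := hγs ((β A) ∘ₗ T)
  have hA : ∀ Y, β (A - T X) (T Y) = 0 := fun Y => by
    have := LinearMap.congr_fun hX Y
    rw [map_sub, LinearMap.sub_apply, sub_eq_zero]
    exact this.symm
  refine ⟨X, ?_⟩
  have : A - T X = 0 := eq_zero_of_lie_eq_zero fun Y => by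
    apply hγ
    rw [map_zero]
    refine LinearMap.ext fun Z => ?_
    change β (T ⁅A - T X, Y⁆) (T Z) = 0
    rw [hT]
    have := LieModule.traceForm_apply_lie_apply ℝ h V (A - T X) (T Y) (T Z)
    change β ⁅A - T X, T Y⁆ (T Z) = β (A - T X) ⁅T Y, T Z⁆ at this
    rw [this, ← hT]
    exact hA _
  exact (sub_eq_zero.1 this).symm

theorem exists_equiv (hirr : LieModule.IsIrreducible ℝ h V)
    (hinv : LieModule.maxTrivSubmodule ℝ h (V ⊗[ℝ] h) ≠ ⊥) : Nonempty (V ≃ₗ⁅ℝ, h⁆ h) := by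
  obtain ⟨τ, hτ, hτ0⟩ := (Submodule.ne_bot_iff _).1
    (mt (LieSubmodule.toSubmodule_eq_bot (N := LieModule.maxTrivSubmodule ℝ h (V ⊗[ℝ] h))).1 hinv)
  have hT0 : contract h τ ≠ 0 := fun h0 => hτ0 (contract_injective h (h0.trans (map_zero _).symm))
  have hb := bijective_of_map_lie hirr hT0 (contract_map_lie hτ)
  let e := LinearEquiv.ofBijective _ hb
  exact ⟨{ e with map_lie' := fun {x m} => contract_map_lie hτ x m }⟩

omit [FiniteDimensional ℝ V] in
theorem isSimple_of_equiv (hirr : LieModule.IsIrreducible ℝ h V) (φ : V ≃ₗ⁅ℝ, h⁆ h) :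
    LieAlgebra.IsSimple ℝ h where
  eq_bot_or_eq_top I := by
    let N : LieSubmodule ℝ h V :=
      { (I.toSubmodule).comap (φ.toLieModuleHom : V →ₗ[ℝ] h) with
        lie_mem := fun {x m} hm => by
          have hm : φ m ∈ I := hm
          change φ ⁅x, m⁆ ∈ I
          rw [map_lie_equiv]
          exact I.lie_mem hm }
    have hN : ∀ x, x ∈ I ↔ φ.symm x ∈ N := fun x => by
      change x ∈ I ↔ φ (φ.symm x) ∈ I
      rw [φ.apply_symm_apply]
    rcases eq_bot_or_eq_top N with h0 | h0
    · left
      refine (LieSubmodule.eq_bot_iff _).2 fun x hx => ?_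
      rw [hN, h0, LieSubmodule.mem_bot] at hx
      rw [← φ.apply_symm_apply x, hx, map_zero]
    · right
      refine eq_top_iff.2 fun x _ => ?_
      rw [hN, h0]
      trivial
  non_abelian hab := by
    have : Nontrivial V := (LieSubmodule.nontrivial_iff ℝ h V).1 hirr.toNontrivial
    obtain ⟨X, hX⟩ := exists_ne (0 : V)
    have : φ X = 0 := eq_zero_of_lie_eq_zero fun Y => by
      apply φ.injective
      rw [map_lie_equiv, map_zero]
      exact hab.trivial _ _
    exact hX ((map_eq_zero_iff φ φ.injective).1 this)

theorem exists_tensor3_eq (hirr : LieModule.IsIrreducible ℝ h V) (φ : V ≃ₗ⁅ℝ, h⁆ h)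
    {τ : V ⊗[ℝ] h} (hτ : τ ∈ LieModule.maxTrivSubmodule ℝ h (V ⊗[ℝ] h)) :
    ∃ c : ℝ, ∀ X Y Z : V, tensor3 h τ X Y Z = c * canonicalForm h φ ![X, Y, Z] := by
  let f : V →ₗ[ℝ] V := (φ.symm.toLieModuleHom : h →ₗ[ℝ] V) ∘ₗ contract h τ
  have hf : ∀ X, φ (f X) = contract h τ X := fun X => φ.apply_symm_apply _
  obtain ⟨c, hc⟩ := (isSimpleBracket_bracket hirr φ).isScalar_of_comm (f := f) fun X Y => by
    apply φ.injective
    rw [bracket_apply, bracket_apply, hf, map_lie_equiv, hf, contract_map_lie hτ]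
  refine ⟨c, fun X Y Z => ?_⟩
  rw [tensor3, canonicalForm_apply, symm_lie, ← hf, hc, map_smul, smul_lie, inner_smul_left]
  rfl

end Bracket

/-! ### Curvature tensors with values in `𝔥` as symmetric endomorphisms -/

section CurvatureOfEndomorphism

variable {V : Type*} [NormedAddCommGroup V] [InnerProductSpace ℝ V]
  {h : LieSubalgebra ℝ (so V)}

/-- The tensor `(X, Y, Z) ↦ [S [X, Y], Z]` associated with an endomorphism `S` of `V ≅ 𝔥`. -/
noncomputable def endTensor (φ : V ≃ₗ⁅ℝ, h⁆ h) : (V →ₗ[ℝ] V) →ₗ[ℝ] Tensor4 V where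
  toFun S := (bracket φ).compr₂ (bracket φ ∘ₗ S)
  map_add' S T := by ext; simp
  map_smul' c S := by ext; simp

@[simp]
theorem endTensor_apply (φ : V ≃ₗ⁅ℝ, h⁆ h) (S : V →ₗ[ℝ] V) (X Y Z : V) :
    endTensor φ S X Y Z = bracket φ (S (bracket φ X Y)) Z := rfl

theorem endTensor_mem_symOf (hirr : LieModule.IsIrreducible ℝ h V) (φ : V ≃ₗ⁅ℝ, h⁆ h)
    {S : V →ₗ[ℝ] V} (hS : S.IsSymmetric) : endTensor φ S ∈ symOf h := by
  have hB := isSimpleBracket_bracket hirr φ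
  refine ⟨⟨fun X Y Z W => ?_, fun X Y Z W => ?_, fun X Y Z W => ?_⟩, fun X Y => ?_⟩
  · rw [endTensor_apply, endTensor_apply, hB.skew X Y]; simp
  · rw [endTensor_apply, endTensor_apply, hB.inner_right, real_inner_comm]
  · rw [endTensor_apply, endTensor_apply, hB.inner_assoc, hB.inner_assoc, hS, real_inner_comm]
  · exact ⟨φ (S (bracket φ X Y)), (φ (S (bracket φ X Y))).2, fun Z => rfl⟩

variable [FiniteDimensional ℝ V]

theorem endTensor_injective (hirr : LieModule.IsIrreducible ℝ h V) (φ : V ≃ₗ⁅ℝ, h⁆ h) :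
    Function.Injective (endTensor φ) := by
  have hB := isSimpleBracket_bracket hirr φ
  refine (injective_iff_map_eq_zero _).2 fun S hS => LinearMap.ker_eq_top.1
    (hB.eq_top_of_lie_mem fun X Y => LinearMap.mem_ker.2 (hB.faithful _ fun Z => ?_))
  rw [← endTensor_apply, hS]; rfl

/-- Pair symmetry makes the `𝔥`-value of `R` at a tensor in `V ⊗ V` depend only on the bracket of
that tensor, so it descends to an endomorphism `S`. -/
theorem exists_endTensor_eq (hirr : LieModule.IsIrreducible ℝ h V) (φ : V ≃ₗ⁅ℝ, h⁆ h)
    {R : Tensor4 V} (hR : R ∈ symOf h) : ∃ S : V →ₗ[ℝ] V, S.IsSymmetric ∧ endTensor φ S = R := by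
  have hB := isSimpleBracket_bracket hirr φ
  obtain ⟨⟨-, -, hpair⟩, hval⟩ := hR
  have hBinj : LinearMap.ker (bracket φ) = ⊥ := LinearMap.ker_eq_bot.2
    ((injective_iff_map_eq_zero _).2 fun X hX => hB.faithful X fun Y => by rw [hX]; rfl)
  -- A linear left inverse of `ad` makes the choice of the `𝔥`-value of `R X Y` bilinear.
  obtain ⟨l, hl⟩ := (bracket φ).exists_leftInverse_of_injective hBinj
  let ρ : V →ₗ[ℝ] V →ₗ[ℝ] V := R.compr₂ l
  have hρ : ∀ X Y Z, bracket φ (ρ X Y) Z = R X Y Z := by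
    intro X Y Z
    obtain ⟨A, hA, hRA⟩ := hval X Y
    have h1 : R X Y = bracket φ (φ.symm ⟨A, hA⟩) := by
      ext Z
      rw [hRA, bracket_apply, φ.apply_symm_apply]; rfl
    have h2 : ρ X Y = φ.symm ⟨A, hA⟩ := by
      change l (R X Y) = _
      rw [h1]
      exact LinearMap.congr_fun hl _
    rw [h2, h1]
  have hρi : ∀ X Y Z W, ⟪ρ X Y, bracket φ Z W⟫ = ⟪R X Y Z, W⟫ := fun X Y Z W => by
    rw [← hB.inner_assoc, hρ]
  have hsurj : LinearMap.range (TensorProduct.lift (bracket φ)) = ⊤ :=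
    hB.eq_top_of_lie_mem fun X Y => ⟨X ⊗ₜ Y, TensorProduct.lift.tmul _ _⟩
  obtain ⟨g, hg⟩ := (TensorProduct.lift (bracket φ)).exists_rightInverse_of_surjective hsurj
  have hfac : ∀ (s : V ⊗[ℝ] V) Z W,
      ⟪TensorProduct.lift ρ s, bracket φ Z W⟫ = ⟪ρ Z W, TensorProduct.lift (bracket φ) s⟫ := by
    intro s Z W
    induction s using TensorProduct.induction_on with
    | zero => simp
    | tmul X Y => rw [TensorProduct.lift.tmul, TensorProduct.lift.tmul, hρi, hρi, hpair]
    | add a b ha hb => rw [map_add, map_add, inner_add_left, inner_add_right, ha, hb]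
  let S : V →ₗ[ℝ] V := TensorProduct.lift ρ ∘ₗ g
  have hSi : ∀ P Z W, ⟪S P, bracket φ Z W⟫ = ⟪ρ Z W, P⟫ := fun P Z W => by
    have := hfac (g P) Z W
    rwa [show TensorProduct.lift (bracket φ) (g P) = P from LinearMap.congr_fun hg P] at this
  have hSρ : ∀ X Y, S (bracket φ X Y) = ρ X Y := fun X Y => by
    refine sub_eq_zero.1 (hB.eq_zero_of_inner_lie fun Z W => ?_)
    rw [inner_sub_left, hSi, hρi, hρi, hpair, sub_self]
  refine ⟨S, fun P Q => ?_, ?_⟩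
  · have : LinearMap.ker (innerₗ V (S P) - innerₗ V P ∘ₗ S) = ⊤ :=
      hB.eq_top_of_lie_mem fun Z W => by
        rw [LinearMap.mem_ker]
        change ⟪S P, bracket φ Z W⟫ - ⟪P, S (bracket φ Z W)⟫ = 0
        rw [hSi, hSρ, real_inner_comm, sub_self]
    have h2 : Q ∈ LinearMap.ker (innerₗ V (S P) - innerₗ V P ∘ₗ S) := this ▸ Submodule.mem_top
    exact sub_eq_zero.1 (LinearMap.mem_ker.1 h2)
  · ext X Y Z
    rw [endTensor_apply, hSρ, hρ]

/-- If the rank of `𝔥` is at least two, then all centralizers have dimension at least two. -/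
theorem exists_lie_eq_zero_of_two_le_rank (hirr : LieModule.IsIrreducible ℝ h V)
    (φ : V ≃ₗ⁅ℝ, h⁆ h) (hr : 2 ≤ LieAlgebra.rank ℝ h) (X : V) :
    ∃ Y, bracket φ X Y = 0 ∧ Y ∉ Submodule.span ℝ {X} := by
  have hB := isSimpleBracket_bracket hirr φ
  by_contra! hcon
  have hpow : ∀ (n : ℕ) (y : h),
      (LieAlgebra.ad ℝ h (φ X) ^ n) y = φ ((bracket φ X ^ n) (φ.symm y)) := by
    intro n
    induction n with
    | zero => intro y; simp
    | succ n ih =>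
      intro y
      rw [pow_succ', pow_succ', Module.End.mul_apply, Module.End.mul_apply, ih, LieAlgebra.ad_apply,
        bracket_apply, map_lie_equiv]
  -- A skew `ad X` has no nilpotent part, so the Engel subalgebra is just the centralizer, and its
  -- dimension bounds the rank.
  have hker : ∀ (n : ℕ) (Y : V), (bracket φ X ^ n) Y = 0 → bracket φ X Y = 0 := by
    intro n
    induction n with
    | zero => intro Y hY; rw [show Y = 0 from hY, map_zero]
    | succ n ih =>
      intro Y hY
      rw [pow_succ, Module.End.mul_apply] at hY
      exact hB.eq_zero_of_apply_apply (ih _ hY)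
  have hle : (LieSubalgebra.engel ℝ (φ X)).toSubmodule ≤ Submodule.span ℝ {φ X} := by
    intro y hy
    obtain ⟨n, hn⟩ := (LieSubalgebra.mem_engel_iff ℝ (φ X) y).1 hy
    rw [hpow, map_eq_zero_iff φ φ.injective] at hn
    obtain ⟨c, hc⟩ := Submodule.mem_span_singleton.1 (hcon _ (hker n _ hn))
    refine Submodule.mem_span_singleton.2 ⟨c, ?_⟩
    rw [← φ.apply_symm_apply y, ← hc, map_smul]
  have h1 := LieAlgebra.rank_le_finrank_engel ℝ (φ X)
  have h2 := Submodule.finrank_mono hle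
  have h3 : Module.finrank ℝ (Submodule.span ℝ {φ X}) ≤ 1 := by
    simpa using finrank_span_le_card (R := ℝ) ({φ X} : Set h)
  have h4 : Module.finrank ℝ (LieSubalgebra.engel ℝ (φ X)) ≤
    Module.finrank ℝ (Submodule.span ℝ {φ X}) := h2
  omega

omit [FiniteDimensional ℝ V] in
theorem lie_endTensor (φ : V ≃ₗ⁅ℝ, h⁆ h) (x : h) (S : V →ₗ[ℝ] V) :
    ⁅x, endTensor φ S⁆ =
      endTensor φ (LieModule.toEnd ℝ h V x ∘ₗ S - S ∘ₗ LieModule.toEnd ℝ h V x) := by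
  ext X Y Z
  have e : ⁅x, endTensor φ S⁆ X Y Z = ⁅(x : so V), endTensor φ S⁆ X Y Z := rfl
  have e2 : ∀ Y : V, ⁅(x : so V), Y⁆ = ⁅x, Y⁆ := fun _ => rfl
  have e3 : ⁅x, ⁅φ X, Y⁆⁆ = ⁅φ ⁅x, X⁆, Y⁆ + ⁅φ X, ⁅x, Y⁆⁆ := by
    rw [leibniz_lie, map_lie_equiv]
  rw [e, lie_tensor4_apply]
  simp only [e2, endTensor_apply, bracket_apply, LinearMap.sub_apply, LinearMap.comp_apply,
    LieModule.toEnd_apply_apply, e3, map_sub, map_add, LinearMap.add_apply]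
  rw [leibniz_lie x _ Z, ← map_lie_equiv]
  abel

theorem curvOf_of_two_le_rank (hirr : LieModule.IsIrreducible ℝ h V)
    (φ : V ≃ₗ⁅ℝ, h⁆ h) (hr : 2 ≤ LieAlgebra.rank ℝ h) :
    LieModule.IsTrivial h (curvOf h) ∧ Nonempty (curvOf h ≃ₗ[ℝ] ℝ) := by
  have hB := isSimpleBracket_bracket hirr φ
  have hV : Nontrivial V := (LieSubmodule.nontrivial_iff ℝ h V).1 hirr.toNontrivial
  have hid : (LinearMap.id : V →ₗ[ℝ] V).IsSymmetric := fun _ _ => rfl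
  have h0 : endTensor φ LinearMap.id ∈ curvOf h := by
    have hs := endTensor_mem_symOf hirr φ hid
    refine ⟨⟨hs.1, fun X Y Z => ?_⟩, hs⟩
    simp only [bianchi, endTensor_apply, LinearMap.id_apply]
    rw [hB.skew (bracket φ Y Z) X, hB.jacobi X Y Z, hB.skew Z X, map_neg, LinearMap.neg_apply,
      hB.skew (bracket φ X Z) Y]
    abel
  have hspan : ∀ R ∈ curvOf h, ∃ c : ℝ, R = c • endTensor φ LinearMap.id := by
    rintro R ⟨⟨-, hb⟩, hR⟩
    obtain ⟨S, hS, rfl⟩ := exists_endTensor_eq hirr φ hR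
    obtain ⟨c, hc⟩ := hB.isScalar_of_bianchi (exists_lie_eq_zero_of_two_le_rank hirr φ hr) hS hb
    refine ⟨c, ?_⟩
    rw [← map_smul]
    congr 1
    ext X
    rw [hc]; rfl
  constructor
  · refine ⟨fun x R => Subtype.ext ?_⟩
    obtain ⟨c, hc⟩ := hspan R R.2
    change ⁅x, (R : Tensor4 V)⁆ = 0
    rw [hc, ← map_smul, lie_endTensor, LinearMap.comp_smul, LinearMap.smul_comp,
      LinearMap.comp_id, LinearMap.id_comp, sub_self, map_zero]
  · let f : ℝ →ₗ[ℝ] curvOf h :=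
      { toFun := fun c => ⟨c • endTensor φ LinearMap.id, (curvOf h).smul_mem c h0⟩
        map_add' := fun c d => Subtype.ext (add_smul c d _)
        map_smul' := fun c d => Subtype.ext (mul_smul c d _) }
    refine ⟨(LinearEquiv.ofBijective f ⟨fun c d hcd => ?_, fun R => ?_⟩).symm⟩
    · have h3 : c • endTensor φ LinearMap.id = d • endTensor φ LinearMap.id := Subtype.ext_iff.1 hcd
      rw [← map_smul, ← map_smul] at h3
      obtain ⟨X, hX⟩ := exists_ne (0 : V)
      exact smul_left_injective ℝ hX (LinearMap.congr_fun (endTensor_injective hirr φ h3) X)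
    · obtain ⟨c, hc⟩ := hspan R R.2
      exact ⟨c, Subtype.ext hc.symm⟩

end CurvatureOfEndomorphism

/-! ### The case `so(3)` -/

section DimensionThree

theorem mem_so_iff {V : Type*} [NormedAddCommGroup V] [InnerProductSpace ℝ V]
    {f : Module.End ℝ V} : f ∈ so V ↔ ∀ X Y, ⟪f X, Y⟫ = -⟪X, f Y⟫ := by
  refine (LinearMap.mem_skewAdjointSubmodule (B := innerₗ V) (f := f)).trans
    (forall₂_congr fun X Y => ?_)
  change ⟪f X, Y⟫ = ⟪X, -f Y⟫ ↔ _
  rw [inner_neg_right]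

/-- The cross product with a fixed vector, as a skew-symmetric endomorphism. -/
noncomputable def crossSo :
    EuclideanSpace ℝ (Fin 3) →ₗ[ℝ] so (EuclideanSpace ℝ (Fin 3)) where
  toFun v := ⟨
    { toFun := fun X => !₂[v 1 * X 2 - v 2 * X 1, v 2 * X 0 - v 0 * X 2, v 0 * X 1 - v 1 * X 0]
      map_add' := fun X Y => by
        ext i; fin_cases i <;> simp <;> ring
      map_smul' := fun c X => by
        ext i; fin_cases i <;> simp <;> ring },
    mem_so_iff.2 fun X Y => by
      simp [PiLp.inner_apply, Fin.sum_univ_three]; ring⟩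
  map_add' v w := by
    ext X i; fin_cases i <;> simp <;> ring
  map_smul' c v := by
    ext X i; fin_cases i <;> simp <;> ring

theorem crossSo_lie (v X : EuclideanSpace ℝ (Fin 3)) : ⁅crossSo v, X⁆ =
    !₂[v 1 * X 2 - v 2 * X 1, v 2 * X 0 - v 0 * X 2, v 0 * X 1 - v 1 * X 0] := rfl

theorem crossSo_bijective : Function.Bijective crossSo := by
  let E : Fin 3 → EuclideanSpace ℝ (Fin 3) := fun j => EuclideanSpace.single j 1
  have hext : ∀ A C : so (EuclideanSpace ℝ (Fin 3)),
      (∀ i j, ⁅A, E j⁆ i = ⁅C, E j⁆ i) →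
      A = C := fun A C hAC => Subtype.ext ((EuclideanSpace.basisFun (Fin 3) ℝ).toBasis.ext
        fun j => by
          rw [OrthonormalBasis.coe_toBasis, EuclideanSpace.basisFun_apply]
          ext i
          exact hAC i j)
  constructor
  · intro v w hvw
    have h1 := fun i j => congrArg
      (fun A : so (EuclideanSpace ℝ (Fin 3)) => ⁅A, E j⁆ i) hvw
    have h10 := h1 1 0
    have h21 := h1 2 1
    have h02 := h1 0 2
    simp only [crossSo_lie] at h10 h21 h02
    simp [E] at h10 h21 h02
    ext i
    fin_cases i <;> assumption
  · intro A
    have hA : ∀ i j, ⁅A, E j⁆ i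
        = -⁅A, E i⁆ j := fun i j => by
      have := inner_so A (E j) (E i)
      simp only [E] at this ⊢
      rwa [EuclideanSpace.inner_single_right, EuclideanSpace.inner_single_left, one_mul, map_one,
        one_mul] at this
    refine ⟨!₂[⁅A, E 1⁆ 2, ⁅A, E 2⁆ 0,
      ⁅A, E 0⁆ 1], hext _ _ fun i j => ?_⟩
    rw [crossSo_lie]
    have h00 := hA 0 0
    have h11 := hA 1 1
    have h22 := hA 2 2
    have h01 := hA 0 1
    have h12 := hA 1 2
    have h20 := hA 2 0
    fin_cases i <;> fin_cases j <;> simp [E] at * <;> linarith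

/-- The isomorphism `ℝ³ ≅ so(3)` given by the cross product. -/
noncomputable def crossEquiv :
    EuclideanSpace ℝ (Fin 3) ≃ₗ[ℝ] so (EuclideanSpace ℝ (Fin 3)) :=
  LinearEquiv.ofBijective crossSo crossSo_bijective

theorem crossEquiv_lie (A : so (EuclideanSpace ℝ (Fin 3))) (v : EuclideanSpace ℝ (Fin 3)) :
    crossEquiv ⁅A, v⁆ = ⁅A, crossEquiv v⁆ := by
  obtain ⟨w, rfl⟩ := crossSo_bijective.2 A
  change crossSo ⁅crossSo w, v⁆ = ⁅crossSo w, crossSo v⁆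
  refine Subtype.ext (LinearMap.ext fun X => ?_)
  change ⁅crossSo ⁅crossSo w, v⁆, X⁆ = ⁅⁅crossSo w, crossSo v⁆, X⁆
  rw [lie_lie]
  simp only [crossSo_lie]
  ext i
  fin_cases i <;> simp <;> ring

variable {V : Type*} [NormedAddCommGroup V] [InnerProductSpace ℝ V] [FiniteDimensional ℝ V]

theorem finrank_so_of_finrank_eq_three (hV : Module.finrank ℝ V = 3) :
    Module.finrank ℝ (so V) ≤ 3 := by
  let ψ : V ≃ₗᵢ[ℝ] EuclideanSpace ℝ (Fin 3) :=
    ((stdOrthonormalBasis ℝ V).reindex (finCongr hV)).repr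
  let F : so V →ₗ[ℝ] so (EuclideanSpace ℝ (Fin 3)) :=
    LinearMap.codRestrict (so (EuclideanSpace ℝ (Fin 3))).toSubmodule
      (ψ.toLinearEquiv.conj.toLinearMap ∘ₗ (so V).toSubmodule.subtype) fun A => by
        refine mem_so_iff.2 fun X Y => ?_
        change ⟪ψ (⁅A, ψ.symm X⁆), Y⟫ = -⟪X, ψ (⁅A, ψ.symm Y⁆)⟫
        rw [← ψ.symm.inner_map_map, ψ.symm_apply_apply, inner_so,
          ← ψ.symm.inner_map_map X, ψ.symm_apply_apply]
  have hF : Function.Injective F := fun A C hAC => Subtype.ext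
    (ψ.toLinearEquiv.conj.injective (Subtype.ext_iff.1 hAC))
  have := LinearMap.finrank_le_finrank_of_injective hF
  rwa [← crossEquiv.finrank_eq, finrank_euclideanSpace_fin] at this

/-- The Bianchi identity is automatic in dimension three. -/
theorem bianchi_eq_zero_of_finrank_eq_three (hV : Module.finrank ℝ V = 3) {R : Tensor4 V}
    (hR : R ∈ symSqLambda V) (X Y Z : V) : bianchi R X Y Z = 0 := by
  obtain ⟨ha, hb, hc⟩ := hR
  let b := Module.finBasisOfFinrankEq ℝ V hV
  have hrot : ∀ X Y Z, bianchi R X Y Z = bianchi R Y Z X := fun X Y Z => by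
    simp only [bianchi]; abel
  have hred : ∀ Y Z, (∀ i, bianchi R (b i) Y Z = 0) → ∀ X, bianchi R X Y Z = 0 := by
    intro Y Z h X
    induction b.mem_span X using Submodule.span_induction with
    | mem X hX => obtain ⟨i, rfl⟩ := hX; exact h i
    | zero => simp [bianchi]
    | add X X' _ _ hX hX' =>
      have : bianchi R (X + X') Y Z = bianchi R X Y Z + bianchi R X' Y Z := by
        simp only [bianchi, map_add, LinearMap.add_apply]; abel
      rw [this, hX, hX', add_zero]
    | smul c X _ hX =>
      have : bianchi R (c • X) Y Z = c • bianchi R X Y Z := by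
        simp only [bianchi, map_smul, LinearMap.smul_apply, smul_add]
      rw [this, hX, smul_zero]
  refine hred Y Z (fun i => ?_) X
  rw [hrot]
  refine hred Z (b i) (fun j => ?_) Y
  rw [hrot]
  refine hred (b i) (b j) (fun k => ?_) Z
  refine InnerProductSpace.ext_inner_right_basis b fun l => ?_
  -- Four indices from three values must repeat, and each coincidence makes the cyclic sum vanish by
  -- the symmetries of `R`.
  have hcase : ∀ k i j l : Fin 3, k = i ∨ k = j ∨ i = j ∨ k = l ∨ i = l ∨ j = l := by decide
  have hval : ∀ P Q S W, P = Q ∨ P = S ∨ Q = S ∨ P = W ∨ Q = W ∨ S = W →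
      ⟪R P Q S, W⟫ + ⟪R Q S P, W⟫ + ⟪R S P Q, W⟫ = 0 := by
    intro P Q S W h
    rcases h with rfl | rfl | rfl | rfl | rfl | rfl
    · linarith [ha P P S W, ha P S P W]
    · linarith [ha P P Q W, ha P Q P W]
    · linarith [ha Q Q P W, ha P Q Q W]
    · linarith [hb Q S P P, hc S P Q P, ha Q P S P]
    · linarith [hb S P Q Q, hc P Q S Q, ha S Q P Q]
    · linarith [hb P Q S S, hc Q S P S, ha P S Q S]
  rw [bianchi, inner_add_left, inner_add_left, inner_zero_left]
  refine hval _ _ _ _ ?_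
  rcases hcase k i j l with rfl | rfl | rfl | rfl | rfl | rfl <;> simp

variable {h : LieSubalgebra ℝ (so V)}

theorem curvOf_eq_curv_of_equiv (φ : V ≃ₗ⁅ℝ, h⁆ h)
    (e : h ≃ₗ⁅ℝ⁆ so (EuclideanSpace ℝ (Fin 3))) :
    Module.finrank ℝ V = 3 ∧ (curvOf h).toSubmodule = (curv V).toSubmodule := by
  have hh : Module.finrank ℝ h = 3 := by
    rw [e.toLinearEquiv.finrank_eq, ← crossEquiv.finrank_eq, finrank_euclideanSpace_fin]
  have hV : Module.finrank ℝ V = 3 := by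
    rw [← hh]
    exact φ.toLinearEquiv.finrank_eq
  refine ⟨hV, inf_eq_left.2 fun R hR => ⟨hR.1, fun X Y => ?_⟩⟩
  -- Both `𝔥` and `so(V)` have dimension three, so taking values in `𝔥` is no condition.
  have htop : h.toSubmodule = ⊤ := by
    refine Submodule.eq_top_of_finrank_eq (le_antisymm (Submodule.finrank_le _) ?_)
    exact (finrank_so_of_finrank_eq_three hV).trans_eq hh.symm
  let A : so V := ⟨R X Y, mem_so_iff.2 fun Z W => by rw [hR.1.2.1, real_inner_comm]⟩
  have hA : A ∈ h.toSubmodule := htop ▸ Submodule.mem_top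
  exact ⟨A, hA, fun Z => rfl⟩

section SymmetricSquareEquiv

variable {L M : Type*} [LieRing L] [LieAlgebra ℝ L] [AddCommGroup M] [Module ℝ M]
  [LieRingModule L M] [LieModule ℝ L M]

/-- The isomorphism `M ⊗ M ≅ End V` induced by an isomorphism `M ≅ V` and the inner product
of `V`. -/
noncomputable def tensorEnd (ι : M ≃ₗ[ℝ] V) : M ⊗[ℝ] M ≃ₗ[ℝ] V →ₗ[ℝ] V :=
  (TensorProduct.congr ι ι).trans (innerTensorHom V V)

theorem tensorEnd_tmul (ι : M ≃ₗ[ℝ] V) (a b : M) (X : V) :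
    tensorEnd ι (a ⊗ₜ b) X = ⟪ι a, X⟫ • ι b :=
  innerTensorHom_tmul V V _ _ _

/-- The action on `M ⊗ M` becomes the commutator, matching `lie_endTensor`. -/
theorem tensorEnd_lie (ι : M ≃ₗ[ℝ] V) {x : h} {y : L} (hι : ∀ v, ι ⁅y, v⁆ = ⁅x, ι v⁆)
    (t : M ⊗[ℝ] M) : tensorEnd ι ⁅y, t⁆ =
      LieModule.toEnd ℝ h V x ∘ₗ tensorEnd ι t - tensorEnd ι t ∘ₗ LieModule.toEnd ℝ h V x := by
  induction t using TensorProduct.induction_on with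
  | zero => simp
  | tmul a b =>
    ext X
    rw [TensorProduct.LieModule.lie_tmul_right, map_add, LinearMap.add_apply, tensorEnd_tmul,
      tensorEnd_tmul, hι, hι, inner_lie, LinearMap.sub_apply, LinearMap.comp_apply,
      LinearMap.comp_apply, tensorEnd_tmul, tensorEnd_tmul, LieModule.toEnd_apply_apply,
      LieModule.toEnd_apply_apply, lie_smul, neg_smul]
    abel
  | add s t hs ht =>
    rw [lie_add, map_add, map_add, hs, ht, LinearMap.comp_add, LinearMap.add_comp]
    abel

theorem inner_tensorEnd_comm (ι : M ≃ₗ[ℝ] V) (t : M ⊗[ℝ] M) (X Y : V) :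
    ⟪tensorEnd ι (TensorProduct.comm ℝ M M t) X, Y⟫ = ⟪X, tensorEnd ι t Y⟫ := by
  induction t using TensorProduct.induction_on with
  | zero => simp
  | tmul a b =>
    rw [TensorProduct.comm_tmul, tensorEnd_tmul, tensorEnd_tmul, inner_smul_left,
      inner_smul_right, real_inner_comm X, mul_comm]
    rfl
  | add s t hs ht =>
    rw [map_add, map_add, map_add, LinearMap.add_apply, LinearMap.add_apply, inner_add_left,
      inner_add_right, hs, ht]

theorem mem_symSq_iff (ι : M ≃ₗ[ℝ] V) (t : M ⊗[ℝ] M) :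
    t ∈ symSq L M ↔ (tensorEnd ι t).IsSymmetric := by
  change TensorProduct.comm ℝ M M t = t ↔ _
  constructor
  · intro ht X Y
    conv_lhs => rw [← ht]
    exact inner_tensorEnd_comm ι t X Y
  · intro ht
    apply (tensorEnd ι).injective
    ext X
    refine ext_inner_right ℝ fun Y => ?_
    rw [inner_tensorEnd_comm, ht]

/-- In dimension three, `𝒦(𝔥)` is isomorphic to the symmetric square of any model of the
representation `V`. -/
theorem exists_curvOf_equiv_symSq (hirr : LieModule.IsIrreducible ℝ h V) (φ : V ≃ₗ⁅ℝ, h⁆ h)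
    (hV : Module.finrank ℝ V = 3) (e : h → L) (ι : M ≃ₗ[ℝ] V)
    (hι : ∀ x v, ι ⁅e x, v⁆ = ⁅x, ι v⁆) :
    ∃ f : curvOf h ≃ₗ[ℝ] symSq L M, ∀ (x : h) (R : curvOf h), f ⁅x, R⁆ = ⁅e x, f R⁆ := by
  have hmem : ∀ t ∈ symSq L M, endTensor φ (tensorEnd ι t) ∈ curvOf h := fun t ht =>
    have hs := endTensor_mem_symOf hirr φ ((mem_symSq_iff ι t).1 ht)
    ⟨⟨hs.1, bianchi_eq_zero_of_finrank_eq_three hV hs.1⟩, hs⟩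
  let g : symSq L M →ₗ[ℝ] curvOf h :=
    { toFun := fun t => ⟨endTensor φ (tensorEnd ι t), hmem t t.2⟩
      map_add' := fun s t => Subtype.ext
        (((endTensor φ ∘ₗ (tensorEnd ι).toLinearMap)).map_add (s : M ⊗[ℝ] M) t)
      map_smul' := fun c t => Subtype.ext
        (((endTensor φ ∘ₗ (tensorEnd ι).toLinearMap)).map_smul c (t : M ⊗[ℝ] M)) }
  have hgval : ∀ t, (g t : Tensor4 V) = endTensor φ (tensorEnd ι t) := fun _ => rfl
  have hg : Function.Bijective g := by
    constructor
    · intro s t hst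
      have h1 : (g s : Tensor4 V) = g t := by rw [hst]
      rw [hgval, hgval] at h1
      exact Subtype.ext ((tensorEnd ι).injective (endTensor_injective hirr φ h1))
    · intro R
      obtain ⟨S, hS, hSR⟩ := exists_endTensor_eq hirr φ R.2.2
      refine ⟨⟨(tensorEnd ι).symm S, (mem_symSq_iff ι _).2
        (by rwa [LinearEquiv.apply_symm_apply])⟩, Subtype.ext ?_⟩
      rw [hgval, LinearEquiv.apply_symm_apply, hSR]
  refine ⟨(LinearEquiv.ofBijective g hg).symm, fun x R => ?_⟩
  obtain ⟨t, rfl⟩ := (LinearEquiv.ofBijective g hg).surjective R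
  rw [LinearEquiv.symm_apply_eq, LinearEquiv.symm_apply_apply, LinearEquiv.ofBijective_apply,
    LinearEquiv.ofBijective_apply]
  refine Subtype.ext ?_
  change ⁅x, (g t : Tensor4 V)⁆ = _
  rw [hgval, hgval, lie_endTensor, ← tensorEnd_lie ι (hι x)]
  rfl

end SymmetricSquareEquiv

theorem exists_curvOf_equiv_symSq_of_equiv (hirr : LieModule.IsIrreducible ℝ h V)
    (φ : V ≃ₗ⁅ℝ, h⁆ h) (e : h ≃ₗ⁅ℝ⁆ so (EuclideanSpace ℝ (Fin 3))) :
    ∃ f : curvOf h ≃ₗ[ℝ] symSq (so (EuclideanSpace ℝ (Fin 3))) (EuclideanSpace ℝ (Fin 3)),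
      ∀ (x : h) (R : curvOf h), f ⁅x, R⁆ = ⁅e x, f R⁆ := by
  refine exists_curvOf_equiv_symSq hirr φ (curvOf_eq_curv_of_equiv φ e).1 e
    ((crossEquiv.trans e.symm.toLinearEquiv).trans φ.symm.toLinearEquiv) fun x v => ?_
  change φ.symm (e.symm (crossEquiv ⁅e x, v⁆)) = ⁅x, φ.symm (e.symm (crossEquiv v))⁆
  apply φ.injective
  rw [crossEquiv_lie, LieEquiv.map_lie, e.symm_apply_apply, map_lie_equiv, φ.apply_symm_apply,
    φ.apply_symm_apply]

end DimensionThree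

end SkewCurv

theorem mainTheorem10 {V : Type*} [NormedAddCommGroup V] [InnerProductSpace ℝ V]
    [FiniteDimensional ℝ V] (h : LieSubalgebra ℝ (SkewCurv.so V))
    (hirr : LieModule.IsIrreducible ℝ h V)
    (hinv : LieModule.maxTrivSubmodule ℝ h (V ⊗[ℝ] h) ≠ ⊥) :
    (LieAlgebra.IsSimple ℝ h ∧ Nonempty (V ≃ₗ⁅ℝ, h⁆ h)) ∧
    (2 ≤ LieAlgebra.rank ℝ h →
      LieModule.IsTrivial h (SkewCurv.curvOf h) ∧ Nonempty (SkewCurv.curvOf h ≃ₗ[ℝ] ℝ)) ∧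
    (∀ e : h ≃ₗ⁅ℝ⁆ SkewCurv.so (EuclideanSpace ℝ (Fin 3)),
      (SkewCurv.curvOf h).toSubmodule = (SkewCurv.curv V).toSubmodule ∧
      ∃ f : SkewCurv.curvOf h ≃ₗ[ℝ]
          SkewCurv.symSq (SkewCurv.so (EuclideanSpace ℝ (Fin 3))) (EuclideanSpace ℝ (Fin 3)),
        ∀ (x : h) (R : SkewCurv.curvOf h), f ⁅x, R⁆ = ⁅e x, f R⁆) ∧
    (∀ (φ : V ≃ₗ⁅ℝ, h⁆ h), ∀ τ ∈ LieModule.maxTrivSubmodule ℝ h (V ⊗[ℝ] h),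
      ∃ c : ℝ, ∀ X Y Z : V,
        SkewCurv.tensor3 h τ X Y Z = c * SkewCurv.canonicalForm h φ ![X, Y, Z]) := by
  obtain ⟨φ⟩ := SkewCurv.exists_equiv hirr hinv
  exact ⟨⟨SkewCurv.isSimple_of_equiv hirr φ, ⟨φ⟩⟩,
    SkewCurv.curvOf_of_two_le_rank hirr φ,
    fun e => ⟨(SkewCurv.curvOf_eq_curv_of_equiv φ e).2,
      SkewCurv.exists_curvOf_equiv_symSq_of_equiv hirr φ e⟩,
    fun φ _ hτ => SkewCurv.exists_tensor3_eq hirr φ hτ⟩
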